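/- Let $T\ge 1$ be the number of tokens. A query $q=(q_1,\dots,q_{\mathrm{len}(q)})$ and a document $d=(d_1,\dots,d_{\mathrm{len}(d)})$ are nonempty finite sequences of tokens in $[T]$; a query encoder and a document encoder assign to every position a (possibly context-dependent) vector $E_q(q_i)$, $E_d(d_j)$ in $\mathbb{R}^m$. For $w\in\mathbb{R}^T$ the Weighted Chamfer score is $$\eta_w(q,d)=\frac{1}{\mathrm{len}(q)}\sum_{i=1}^{\mathrm{len}(q)} w_{q_i}\,\min_{j\in[\mathrm{len}(d)]}\|E_q(q_i)-E_d(d_j)\|_2,$$ and $$\mathcal{H}=\{(q,d)\mapsto \mathbb{I}[\eta_w(q,d)\ge\tau] \mid w\in\mathbb{R}^T,\ \tau\in\mathbb{R}\}.$$ Let $\mathfrak{D}$ be a probability distribution on labelled pairs $(x,y)$, where $x=(q,d)$ is a query-document pair and $y\in\{0,1\}$ is its relevance label, and let $\ell((x,y),h)=\ell((x,y),h(x))$ be a real loss that depends on $h$ through the prediction $h(x)\in\{0,1\}$, is $1$-Lipschitz in it, and is $\mathfrak{D}$-integrable for each of the two predictions (for instance the $0$-$1$ loss). Put $L(h)=\mathbb{E}_{(x,y)\sim\mathfrak{D}}[\ell((x,y),h)]$,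 and for a sample $(x^{(i)},y^{(i)})_{i=1}^n$ put $\hat L(h)=\frac1n\sum_{i=1}^n \ell((x^{(i)},y^{(i)}),h)$. For every $\varepsilon_0<1$ there is a constant $C>0$, depending only on $\varepsilon_0$, such that for all $T$, $m$, encoders, $\mathfrak{D}$ and $\ell$ as above, all $\varepsilon\in(0,\varepsilon_0]\cup[1,\infty)$, all $\delta\in(0,1)$ and all integers $n \ge 0$ with $$n\ \ge\ C\,\frac{T\log(1/\varepsilon)+\log(1/\delta)}{\varepsilon^2},$$ the following holds with probability at least $1-\delta$ over an i.i.d. sample of size $n$ from $\mathfrak{D}$: every empirical risk minimizer $\hat h\in\arg\min_{h\in\mathcal{H}}\hat L(h)$ satisfies $|L(\hat h)-\inf_{h\in\mathcal{H}}L(h)|\le\varepsilon$; in particular $|L(\hat h)-L(h^*)|\le\varepsilon$ for every $h^*\in\arg\min_{h\in\mathcal{H}}L(h)$. -/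

import Mathlib

open MeasureTheory

noncomputable section

namespace WeightedChamfer

/-- A query or a document: a nonempty finite sequence of tokens from the universe `[T]`. -/
def TokenSeq (T : ℕ) : Type := {l : List (Fin T) // l ≠ []}

namespace TokenSeq

variable {T : ℕ}

/-- The number of tokens. -/
def len (s : TokenSeq T) : ℕ := s.1.length

/-- The token at position `i`. -/
def token (s : TokenSeq T) (i : Fin s.len) : Fin T := s.1.get i

end TokenSeq

instance (T : ℕ) : Countable (TokenSeq T) :=
  inferInstanceAs (Countable {l : List (Fin T) // l ≠ []})

/-- The countable set of token sequences carries the discrete σ-algebra. -/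
instance (T : ℕ) : MeasurableSpace (TokenSeq T) := ⊤

instance (T : ℕ) : DiscreteMeasurableSpace (TokenSeq T) := ⟨fun _ => trivial⟩

/-- A token-level encoder into `ℝ^m`: one embedding vector for each position of the sequence.
The vector at a position may depend on the whole sequence (contextual embedding). -/
abbrev Encoder (T m : ℕ) : Type := (s : TokenSeq T) → Fin s.len → EuclideanSpace ℝ (Fin m)

/-- The Weighted Chamfer distance
`η_w(q,d) = (1 / len q) ∑ᵢ w_{qᵢ} · min_j ‖E_q(qᵢ) - E_d(d_j)‖₂`
(the infimum is over a nonempty finite set, hence a minimum). -/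
def weightedChamfer {T m : ℕ} (encQ encD : Encoder T m) (w : Fin T → ℝ) (q d : TokenSeq T) : ℝ :=
  (1 / (q.len : ℝ)) * ∑ i : Fin q.len, w (q.token i) * ⨅ j : Fin d.len, ‖encQ q i - encD d j‖

/-- The class of all classifiers `(q,d) ↦ 𝟙[η_w(q,d) ≥ τ]` with `w ∈ ℝ^T` and `τ ∈ ℝ`. -/
def hypothesisClass {T m : ℕ} (encQ encD : Encoder T m) : Set (TokenSeq T × TokenSeq T → Bool) :=
  {h | ∃ (w : Fin T → ℝ) (τ : ℝ), ∀ q d, h (q, d) = true ↔ weightedChamfer encQ encD w q d ≥ τ}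

/-- Expected risk `L(h) = E_{(x,y) ∼ P} [ℓ((x,y), h(x))]`. -/
def expectedRisk {X : Type*} [MeasurableSpace X] (loss : X × Bool → Bool → ℝ)
    (P : Measure (X × Bool)) (h : X → Bool) : ℝ :=
  ∫ z, loss z (h z.1) ∂P

/-- Empirical risk `(1/n) ∑ᵢ ℓ((xᵢ,yᵢ), h(xᵢ))` on the sample `S`. -/
def empiricalRisk {X : Type*} (loss : X × Bool → Bool → ℝ) {n : ℕ} (S : Fin n → X × Bool)
    (h : X → Bool) : ℝ :=
  (1 / (n : ℝ)) * ∑ i, loss (S i) (h (S i).1)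

/-- `h ∈ argmin_{g ∈ H} R g`. -/
def IsRiskMinimizer {X : Type*} (H : Set (X → Bool)) (R : (X → Bool) → ℝ) (h : X → Bool) : Prop :=
  h ∈ H ∧ ∀ g ∈ H, R h ≤ R g

end WeightedChamfer

end

/-!
Since `η_w(q, d)` is linear in `w`, every classifier of the class is an affine half-space in the
feature space `ℝ^T`, hence a homogeneous half-space in `ℝ^(T+1)`, and the VC dimension is at most
`T + 1`: a linear dependence among more points prescribes a sign pattern no half-space realizes.
By Sauer–Shelah the class cuts out few subsets of `2n` points. Comparing the sample with an
independent ghost sample (Jensen) and then swapping each pair of points at random (Rademacher signs)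
reduces the uniform deviation to finitely many sums of independent signs, each of which has a
sub-Gaussian exponential moment; Markov's inequality gives a uniform law of large numbers.

The sample size carries `T log (1/ε)` where the failure bound has `(T + 1) log (128 / ε ^ 2)`. The
additive constants are absorbed because `log (1/ε) ≥ log (1/ε₀) > 0` when `ε ≤ ε₀ < 1`. When
`1 ≤ ε` there is nothing to prove: two risks never differ by more than `1`.
-/

namespace WeightedChamfer

/-! ### Vapnik–Chervonenkis dimension -/

section VCDimension

variable {X ι : Type*} [Fintype ι] {H : Set (X → Bool)} {d : ℕ}

/-- A class of binary classifiers shatters a finite set of points if it labels the points in every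
possible way. -/
def Shatters (H : Set (X → Bool)) (s : Finset X) : Prop :=
  ∀ t ⊆ s, ∃ h ∈ H, ∀ x ∈ s, h x = true ↔ x ∈ t

/-- The Vapnik–Chervonenkis dimension of the class `H` is at most `d`. -/
def VCDimLE (H : Set (X → Bool)) (d : ℕ) : Prop :=
  ∀ s : Finset X, Shatters H s → s.card ≤ d

lemma VCDimLE.mono {K : Set (X → Bool)} (hK : VCDimLE K d) (hHK : H ⊆ K) : VCDimLE H d :=
  fun s hs => hK s fun t ht =>
    let ⟨h, hh, hht⟩ := hs t ht
    ⟨h, hHK hh, hht⟩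

open Classical in
/-- The sets of indices cut out by the class `H` along a finite family `x` of points, which may
have repetitions. -/
noncomputable def traces (H : Set (X → Bool)) (x : ι → X) : Finset (Finset ι) :=
  Finset.univ.filter fun u => ∃ h ∈ H, ∀ i, h (x i) = true ↔ i ∈ u

lemma mem_traces {x : ι → X} {u : Finset ι} :
    u ∈ traces H x ↔ ∃ h ∈ H, ∀ i, h (x i) = true ↔ i ∈ u := by
  simp [traces]

lemma injOn_of_shatters_traces [DecidableEq ι] {x : ι → X} {s : Finset ι}
    (hs : (traces H x).Shatters s) : Set.InjOn x s := by
  intro i hi j hj hij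
  obtain ⟨u, hu, hsu⟩ := hs.exists_inter_eq_singleton hi
  obtain ⟨h, -, hhu⟩ := mem_traces.1 hu
  have hiu : i ∈ u := Finset.mem_of_mem_inter_right (hsu ▸ Finset.mem_singleton_self i)
  have hju : j ∈ u := (hhu j).1 (hij ▸ (hhu i).2 hiu)
  have hj_mem : j ∈ s ∩ u := Finset.mem_inter.2 ⟨hj, hju⟩
  exact (Finset.mem_singleton.1 (hsu ▸ hj_mem)).symm

lemma shatters_image_of_shatters_traces [DecidableEq ι] [DecidableEq X] {x : ι → X} {s : Finset ι}
    (hs : (traces H x).Shatters s) : Shatters H (s.image x) := by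
  intro t _
  obtain ⟨u, hu, hsu⟩ := hs (Finset.filter_subset (fun i => x i ∈ t) s)
  obtain ⟨h, hh, hhu⟩ := mem_traces.1 hu
  refine ⟨h, hh, Finset.forall_mem_image.2 fun i hi => ?_⟩
  have hi_iff : i ∈ s ∩ u ↔ i ∈ s.filter fun i => x i ∈ t := by rw [hsu]
  simpa only [hhu, Finset.mem_inter, Finset.mem_filter, hi, true_and] using hi_iff

lemma VCDimLE.vcDim_traces_le [DecidableEq ι] (hH : VCDimLE H d) (x : ι → X) :
    (traces H x).vcDim ≤ d := by
  classical
  refine Finset.sup_le fun s hs => ?_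
  rw [Finset.mem_shatterer] at hs
  rw [← Finset.card_image_of_injOn (injOn_of_shatters_traces hs)]
  exact hH _ (shatters_image_of_shatters_traces hs)

lemma VCDimLE.card_traces_le (hH : VCDimLE H d) (x : ι → X) :
    (traces H x).card ≤ ∑ k ∈ Finset.Iic d, (Fintype.card ι).choose k := by
  classical
  exact (Finset.card_le_card_shatterer _).trans <| Finset.card_shatterer_le_sum_vcDim.trans <|
    Finset.sum_le_sum_of_subset (Finset.Iic_subset_Iic.2 (hH.vcDim_traces_le x))

end VCDimension

lemma sum_Iic_choose_mul_pow_le (n d : ℕ) {t : ℝ} (ht : 0 ≤ t) :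
    ∑ k ∈ Finset.Iic d, n.choose k * t ^ k ≤ (t + 1) ^ n := by
  have hrange : ∀ k ∈ (Finset.Iic d).filter fun k => (n.choose k * t ^ k : ℝ) ≠ 0,
      k ∈ Finset.range (n + 1) := by
    intro k hk
    have hchoose : (n.choose k : ℝ) ≠ 0 := left_ne_zero_of_mul (Finset.mem_filter.1 hk).2
    exact Finset.mem_range_succ_iff.2 (le_of_not_gt fun hlt =>
      hchoose (by rw [Nat.choose_eq_zero_of_lt hlt, Nat.cast_zero]))
  calc ∑ k ∈ Finset.Iic d, n.choose k * t ^ k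
      = ∑ k ∈ Finset.Iic d with (n.choose k * t ^ k : ℝ) ≠ 0, n.choose k * t ^ k :=
        (Finset.sum_filter_ne_zero _).symm
    _ ≤ ∑ k ∈ Finset.range (n + 1), n.choose k * t ^ k :=
        Finset.sum_le_sum_of_subset_of_nonneg hrange fun k _ _ => by positivity
    _ = (t + 1) ^ n := by simp only [add_pow, one_pow, mul_one, mul_comm]

/-- The weights `t ^ (k - d) ≥ 1` turn the truncated sum into a part of the binomial expansion of
`(1 + t) ^ n`. -/
lemma sum_Iic_choose_le (n d : ℕ) {t : ℝ} (ht : 0 < t) (ht1 : t ≤ 1) :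
    ∑ k ∈ Finset.Iic d, (n.choose k : ℝ) ≤ (1 / t) ^ d * Real.exp (n * t) := by
  have hterm : ∀ k ∈ Finset.Iic d, (n.choose k : ℝ) ≤ (1 / t) ^ d * (n.choose k * t ^ k) := by
    intro k hk
    have hweight : 1 ≤ (1 / t) ^ d * t ^ k := by
      rw [one_div, inv_pow, inv_mul_eq_div, one_le_div (by positivity)]
      exact pow_le_pow_of_le_one ht.le ht1 (Finset.mem_Iic.1 hk)
    rw [mul_left_comm]
    exact le_mul_of_one_le_right (by positivity) hweight
  calc ∑ k ∈ Finset.Iic d, (n.choose k : ℝ)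
      ≤ ∑ k ∈ Finset.Iic d, (1 / t) ^ d * (n.choose k * t ^ k) := Finset.sum_le_sum hterm
    _ = (1 / t) ^ d * ∑ k ∈ Finset.Iic d, n.choose k * t ^ k := (Finset.mul_sum _ _ _).symm
    _ ≤ (1 / t) ^ d * (t + 1) ^ n := by
        gcongr
        exact sum_Iic_choose_mul_pow_le n d ht.le
    _ ≤ (1 / t) ^ d * Real.exp t ^ n := by
        gcongr
        exact Real.add_one_le_exp t
    _ = (1 / t) ^ d * Real.exp (n * t) := by rw [Real.exp_nat_mul]

/-! ### Half-spaces -/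

section Halfspaces

variable {𝕜 X E : Type*} [Field 𝕜] [LinearOrder 𝕜] [AddCommGroup E] [Module 𝕜 E]

variable (𝕜) in
/-- The classifiers `x ↦ 𝟙[f (φ x) ≥ 0]`, for `f` a linear form on the feature space. -/
def halfspaceClass (φ : X → E) : Set (X → Bool) :=
  {h | ∃ f : Module.Dual 𝕜 E, ∀ x, h x = true ↔ 0 ≤ f (φ x)}

variable (𝕜) in
/-- The classifiers `x ↦ 𝟙[f (φ x) ≥ τ]`, for `f` a linear form on the feature space and `τ` a
threshold. -/
def affineHalfspaceClass (φ : X → E) : Set (X → Bool) :=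
  {h | ∃ (f : Module.Dual 𝕜 E) (τ : 𝕜), ∀ x, h x = true ↔ τ ≤ f (φ x)}

variable [IsStrictOrderedRing 𝕜]

lemma affineHalfspaceClass_subset (φ : X → E) :
    affineHalfspaceClass 𝕜 φ ⊆ halfspaceClass 𝕜 fun x => (φ x, (1 : 𝕜)) := by
  rintro h ⟨f, τ, hf⟩
  refine ⟨f.comp (LinearMap.fst 𝕜 E 𝕜) - τ • LinearMap.snd 𝕜 E 𝕜, fun x => ?_⟩
  simp [hf]

lemma exists_linear_relation_neg {φ : X → E} {s : Finset X}
    (hs : ¬ LinearIndepOn 𝕜 φ (s : Set X)) :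
    ∃ c : X → 𝕜, ∑ x ∈ s, c x • φ x = 0 ∧ ∃ x ∈ s, c x < 0 := by
  obtain ⟨c, hc, x, hx, hcx⟩ := not_linearIndepOn_finset_iff.1 hs
  rcases lt_or_gt_of_ne hcx with hneg | hpos
  · exact ⟨c, hc, x, hx, hneg⟩
  · exact ⟨-c, by simp [hc], x, hx, by simpa using hpos⟩

lemma linearIndepOn_of_shatters_halfspaceClass {φ : X → E} {s : Finset X}
    (hs : Shatters (halfspaceClass 𝕜 φ) s) : LinearIndepOn 𝕜 φ (s : Set X) := by
  classical
  by_contra hdep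
  obtain ⟨c, hc, x₀, hx₀, hneg⟩ := exists_linear_relation_neg hdep
  obtain ⟨h, ⟨f, hf⟩, hh⟩ := hs (s.filter fun x => 0 ≤ c x) (Finset.filter_subset _ _)
  have hsign : ∀ x ∈ s, 0 ≤ f (φ x) ↔ 0 ≤ c x := by
    intro x hx
    rw [← hf, hh x hx, Finset.mem_filter, and_iff_right hx]
  have hnonneg : ∀ x ∈ s, 0 ≤ c x * f (φ x) := by
    intro x hx
    rcases le_or_gt 0 (c x) with hcx | hcx
    · exact mul_nonneg hcx ((hsign x hx).2 hcx)
    · exact mul_nonneg_of_nonpos_of_nonpos hcx.le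
        (le_of_not_ge fun hfx => hcx.not_ge ((hsign x hx).1 hfx))
  have hsum : ∑ x ∈ s, c x * f (φ x) = 0 := by
    simpa only [map_sum, map_smul, smul_eq_mul, map_zero] using congrArg f hc
  have hzero := (Finset.sum_eq_zero_iff_of_nonneg hnonneg).1 hsum x₀ hx₀
  have hfneg : f (φ x₀) < 0 := lt_of_not_ge fun hfx => hneg.not_ge ((hsign x₀ hx₀).1 hfx)
  exact (mul_pos_of_neg_of_neg hneg hfneg).ne' hzero

lemma vcDimLE_halfspaceClass [Module.Finite 𝕜 E] (φ : X → E) :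
    VCDimLE (halfspaceClass 𝕜 φ) (Module.finrank 𝕜 E) := fun s hs => by
  simpa using (linearIndepOn_of_shatters_halfspaceClass hs).fintype_card_le_finrank

lemma vcDimLE_affineHalfspaceClass [Module.Finite 𝕜 E] (φ : X → E) :
    VCDimLE (affineHalfspaceClass 𝕜 φ) (Module.finrank 𝕜 E + 1) := by
  simpa using (vcDimLE_halfspaceClass (𝕜 := 𝕜) fun x => (φ x, (1 : 𝕜))).mono
    (affineHalfspaceClass_subset φ)

end Halfspaces

/-! ### Rademacher sums -/

section Rademacher

variable {ι : Type*} [Fintype ι]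

lemma sum_exp_rademacher_le [DecidableEq ι] (a : ι → ℝ) :
    ∑ s : ι → ℤˣ, Real.exp (∑ i, (s i : ℤ) * a i) ≤
      2 ^ Fintype.card ι * Real.exp ((∑ i, a i ^ 2) / 2) := by
  calc ∑ s : ι → ℤˣ, Real.exp (∑ i, (s i : ℤ) * a i)
      = ∏ i, ∑ e : ℤˣ, Real.exp ((e : ℤ) * a i) := by
        simp only [Real.exp_sum, Fintype.prod_sum]
    _ = ∏ i, 2 * Real.cosh (a i) := by
        refine Finset.prod_congr rfl fun i _ => ?_
        rw [Real.cosh_eq, UnitsInt.univ, Finset.sum_pair (by decide)]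
        simp only [Units.val_one, Units.val_neg, Int.cast_one, Int.cast_neg, one_mul, neg_mul]
        ring
    _ ≤ ∏ i, 2 * Real.exp (a i ^ 2 / 2) := by
        gcongr with i
        exact Real.cosh_le_exp_half_sq (a i)
    _ = 2 ^ Fintype.card ι * Real.exp ((∑ i, a i ^ 2) / 2) := by
        rw [Finset.prod_mul_distrib, Finset.prod_const, Finset.card_univ, ← Real.exp_sum,
          Finset.sum_div]

lemma sum_exp_abs_rademacher_le [DecidableEq ι] (a : ι → ℝ) :
    ∑ s : ι → ℤˣ, Real.exp |∑ i, (s i : ℤ) * a i| ≤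
      2 ^ Fintype.card ι * (2 * Real.exp ((∑ i, a i ^ 2) / 2)) := by
  have hneg := sum_exp_rademacher_le (-a)
  simp only [Pi.neg_apply, mul_neg, Finset.sum_neg_distrib, neg_sq] at hneg
  calc ∑ s : ι → ℤˣ, Real.exp |∑ i, (s i : ℤ) * a i|
      ≤ ∑ s : ι → ℤˣ,
          (Real.exp (∑ i, (s i : ℤ) * a i) + Real.exp (-∑ i, (s i : ℤ) * a i)) := by
        gcongr with s
        exact Real.exp_abs_le _
    _ ≤ 2 ^ Fintype.card ι * (2 * Real.exp ((∑ i, a i ^ 2) / 2)) := by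
        rw [Finset.sum_add_distrib]
        linarith [sum_exp_rademacher_le a]

lemma sum_exp_abs_rademacher_le_of_abs_le [DecidableEq ι] {a : ι → ℝ} {c : ℝ}
    (ha : ∀ i, |a i| ≤ c) :
    ∑ s : ι → ℤˣ, Real.exp |∑ i, (s i : ℤ) * a i| ≤
      2 ^ Fintype.card ι * (2 * Real.exp (Fintype.card ι * c ^ 2 / 2)) := by
  refine (sum_exp_abs_rademacher_le a).trans ?_
  gcongr
  calc ∑ i, a i ^ 2 ≤ ∑ _i : ι, c ^ 2 := Finset.sum_le_sum fun i _ => sq_le_sq.2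
        ((ha i).trans (le_abs_self c))
    _ = Fintype.card ι * c ^ 2 := by simp

end Rademacher

/-! ### Symmetrization -/

section Symmetrization

lemma ofReal_exp_abs_integral_le {Ω : Type*} [MeasurableSpace Ω] {μ : Measure Ω}
    [IsProbabilityMeasure μ] {Y : Ω → ℝ} (hY : Integrable Y μ) :
    ENNReal.ofReal (Real.exp |∫ ω, Y ω ∂μ|) ≤ ∫⁻ ω, ENNReal.ofReal (Real.exp |Y ω|) ∂μ := by
  have hnonneg : 0 ≤ᵐ[μ] fun ω => Real.exp |Y ω| := .of_forall fun ω => (Real.exp_pos _).le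
  have hmeas : AEStronglyMeasurable (fun ω => Real.exp |Y ω|) μ :=
    Real.continuous_exp.comp_aestronglyMeasurable hY.abs.aestronglyMeasurable
  by_cases hexp : Integrable (fun ω => Real.exp |Y ω|) μ
  · rw [← ofReal_integral_eq_lintegral_ofReal hexp hnonneg]
    refine ENNReal.ofReal_le_ofReal ?_
    calc Real.exp |∫ ω, Y ω ∂μ|
        ≤ Real.exp (∫ ω, |Y ω| ∂μ) := Real.exp_le_exp.2 abs_integral_le_integral_abs
      _ ≤ ∫ ω, Real.exp |Y ω| ∂μ :=
          convexOn_exp.map_integral_le Real.continuous_exp.continuousOn isClosed_univ (by simp)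
            hY.abs hexp
  · have htop : ∫⁻ ω, ENNReal.ofReal (Real.exp |Y ω|) ∂μ = ⊤ := by
      by_contra hne
      exact hexp ((lintegral_ofReal_ne_top_iff_integrable hmeas hnonneg).1 hne)
    exact htop ▸ le_top

variable {Z ι : Type*}

/-- The vectors of differences that the class `F` realizes on a family of pairs of points. -/
def differencePatterns (F : Set (Z → ℝ)) (w : ι → Z × Z) : Set (ι → ℝ) :=
  (fun f i => f (w i).1 - f (w i).2) '' F

/-- Exchange a sample point with its ghost where the sign is negative. -/
def swapAlong (s : ι → ℤˣ) (w : ι → Z × Z) : ι → Z × Z :=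
  fun i => if s i = 1 then w i else (w i).swap

lemma sub_swapAlong (f : Z → ℝ) (s : ι → ℤˣ) (w : ι → Z × Z) (i : ι) :
    f (swapAlong s w i).1 - f (swapAlong s w i).2 = (s i : ℤ) * (f (w i).1 - f (w i).2) := by
  rcases Int.units_eq_one_or (s i) with h | h <;> simp [swapAlong, h]

lemma abs_le_of_mem_differencePatterns {F : Set (Z → ℝ)} {b : ℝ} (hF : ∀ f ∈ F, ∀ z, |f z| ≤ b)
    {w : ι → Z × Z} {a : ι → ℝ} (ha : a ∈ differencePatterns F w) (i : ι) : |a i| ≤ 2 * b := by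
  obtain ⟨f, hf, rfl⟩ := ha
  rw [two_mul]
  exact (abs_sub _ _).trans (add_le_add (hF f hf _) (hF f hf _))

lemma encard_differencePatterns_smul_le (c : ℝ) (F : Set (Z → ℝ)) (w : ι → Z × Z) :
    (differencePatterns ((c • ·) '' F) w).encard ≤ (differencePatterns F w).encard := by
  have himage : differencePatterns ((c • ·) '' F) w = (c • ·) '' differencePatterns F w := by
    simp only [differencePatterns, Set.image_image]
    refine Set.image_congr fun f _ => funext fun i => ?_
    simp [mul_sub]
  rw [himage]
  exact Set.encard_image_le _ _

variable [Fintype ι]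

/-- The exponential of the largest deviation, over the class `F`, between a sample and a ghost
sample. -/
noncomputable def expSupDeviation (F : Set (Z → ℝ)) (w : ι → Z × Z) : ENNReal :=
  ⨆ f ∈ F, ENNReal.ofReal (Real.exp |∑ i, (f (w i).1 - f (w i).2)|)

lemma expSupDeviation_swapAlong_le {F : Set (Z → ℝ)} {w : ι → Z × Z} {A : Finset (ι → ℝ)}
    (hA : differencePatterns F w ⊆ A) (s : ι → ℤˣ) :
    expSupDeviation F (swapAlong s w) ≤
      ∑ a ∈ A, ENNReal.ofReal (Real.exp |∑ i, (s i : ℤ) * a i|) := by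
  refine iSup₂_le fun f hf => ?_
  simp only [sub_swapAlong]
  exact Finset.single_le_sum
    (f := fun a : ι → ℝ => ENNReal.ofReal (Real.exp |∑ i, (s i : ℤ) * a i|))
    (fun _ _ => zero_le) (hA (Set.mem_image_of_mem _ hf))

lemma sum_expSupDeviation_swapAlong_le [DecidableEq ι] {F : Set (Z → ℝ)} {b : ℝ}
    (hF : ∀ f ∈ F, ∀ z, |f z| ≤ b) {N : ℕ} {w : ι → Z × Z}
    (hN : (differencePatterns F w).encard ≤ N) :
    ∑ s : ι → ℤˣ, expSupDeviation F (swapAlong s w) ≤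
      2 ^ Fintype.card ι *
        (N * ENNReal.ofReal (2 * Real.exp (2 * Fintype.card ι * b ^ 2))) := by
  obtain ⟨hfin, hcard⟩ := Set.encard_le_coe_iff_finite_ncard_le.1 hN
  set A := hfin.toFinset with hA
  rw [Set.ncard_eq_toFinset_card _ hfin] at hcard
  have hpattern : ∀ a ∈ A, ∑ s : ι → ℤˣ, ENNReal.ofReal (Real.exp |∑ i, (s i : ℤ) * a i|) ≤
      2 ^ Fintype.card ι * ENNReal.ofReal (2 * Real.exp (2 * Fintype.card ι * b ^ 2)) := by
    intro a ha
    rw [← ENNReal.ofReal_sum_of_nonneg fun _ _ => (Real.exp_pos _).le, ← ENNReal.ofReal_ofNat,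
      ← ENNReal.ofReal_pow (by norm_num), ← ENNReal.ofReal_mul (by positivity)]
    refine ENNReal.ofReal_le_ofReal ((sum_exp_abs_rademacher_le_of_abs_le
      (abs_le_of_mem_differencePatterns hF (hfin.mem_toFinset.1 ha))).trans_eq ?_)
    ring_nf
  calc ∑ s : ι → ℤˣ, expSupDeviation F (swapAlong s w)
      ≤ ∑ s : ι → ℤˣ, ∑ a ∈ A, ENNReal.ofReal (Real.exp |∑ i, (s i : ℤ) * a i|) :=
        Finset.sum_le_sum fun s _ => expSupDeviation_swapAlong_le (by simp [hA]) s
    _ = ∑ a ∈ A, ∑ s : ι → ℤˣ, ENNReal.ofReal (Real.exp |∑ i, (s i : ℤ) * a i|) :=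
        Finset.sum_comm
    _ ≤ A.card • (2 ^ Fintype.card ι *
          ENNReal.ofReal (2 * Real.exp (2 * Fintype.card ι * b ^ 2))) :=
        Finset.sum_le_card_nsmul _ _ _ hpattern
    _ ≤ 2 ^ Fintype.card ι *
          (N * ENNReal.ofReal (2 * Real.exp (2 * Fintype.card ι * b ^ 2))) := by
        rw [nsmul_eq_mul, mul_left_comm]
        gcongr

variable [MeasurableSpace Z] (P : Measure Z)

lemma lintegral_lintegral_pi_eq_lintegral_pi_prod [SigmaFinite P] {g : (ι → Z × Z) → ENNReal}
    (hg : Measurable g) :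
    ∫⁻ S, ∫⁻ S', g (fun i => (S i, S' i)) ∂(Measure.pi fun _ : ι => P)
        ∂(Measure.pi fun _ : ι => P) =
      ∫⁻ w, g w ∂(Measure.pi fun _ : ι => P.prod P) := by
  have hpair := measurePreserving_arrowProdEquivProdArrow Z Z ι (fun _ => P) (fun _ => P)
  rw [← hpair.symm.lintegral_comp hg]
  exact lintegral_lintegral (hg.comp hpair.symm.measurable).aemeasurable

variable [IsProbabilityMeasure P]

lemma integral_sum_sub_eq {f : Z → ℝ} (hf : Integrable f P) (S : ι → Z) :
    ∫ S', ∑ i, (f (S i) - f (S' i)) ∂(Measure.pi fun _ : ι => P) =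
      ∑ i, f (S i) - Fintype.card ι * ∫ z, f z ∂P := by
  have hcoord : ∀ i, Integrable (fun S' : ι → Z => f (S' i)) (Measure.pi fun _ : ι => P) :=
    fun i => integrable_comp_eval (μ := fun _ : ι => P) hf
  simp_rw [Finset.sum_sub_distrib]
  rw [integral_sub (integrable_const _) (integrable_finsetSum _ fun i _ => hcoord i),
    integral_finsetSum _ fun i _ => hcoord i]
  simp_rw [integral_comp_eval (μ := fun _ : ι => P) hf.aestronglyMeasurable]
  simp

lemma ofReal_exp_deviation_le_lintegral {f : Z → ℝ} (hf : Integrable f P) (S : ι → Z) :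
    ENNReal.ofReal (Real.exp |∑ i, f (S i) - Fintype.card ι * ∫ z, f z ∂P|) ≤
      ∫⁻ S', ENNReal.ofReal (Real.exp |∑ i, (f (S i) - f (S' i))|)
        ∂(Measure.pi fun _ : ι => P) := by
  rw [← integral_sum_sub_eq P hf S]
  exact ofReal_exp_abs_integral_le <| integrable_finsetSum _ fun i _ =>
    (integrable_const _).sub (integrable_comp_eval (μ := fun _ : ι => P) hf)

lemma measurePreserving_swapAlong (s : ι → ℤˣ) :
    MeasurePreserving (swapAlong s) (Measure.pi fun _ : ι => P.prod P)
      (Measure.pi fun _ : ι => P.prod P) := by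
  refine measurePreserving_pi (fun _ : ι => P.prod P) (fun _ : ι => P.prod P)
    (f := fun i p => if s i = 1 then p else p.swap) fun i => ?_
  split_ifs
  · exact MeasurePreserving.id (P.prod P)
  · exact Measure.measurePreserving_swap

lemma lintegral_le_of_sum_swapAlong_le [DecidableEq ι] {g : (ι → Z × Z) → ENNReal}
    (hg : Measurable g) {B : ENNReal}
    (hB : ∀ w, ∑ s : ι → ℤˣ, g (swapAlong s w) ≤ 2 ^ Fintype.card ι * B) :
    ∫⁻ w, g w ∂(Measure.pi fun _ : ι => P.prod P) ≤ B := by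
  refine (ENNReal.mul_le_mul_iff_right (a := 2 ^ Fintype.card ι) (by simp) (by simp)).1 ?_
  calc 2 ^ Fintype.card ι * ∫⁻ w, g w ∂(Measure.pi fun _ : ι => P.prod P)
      = ∑ s : ι → ℤˣ, ∫⁻ w, g (swapAlong s w) ∂(Measure.pi fun _ : ι => P.prod P) := by
        simp [(measurePreserving_swapAlong P _).lintegral_comp hg]
    _ = ∫⁻ w, ∑ s : ι → ℤˣ, g (swapAlong s w) ∂(Measure.pi fun _ : ι => P.prod P) :=
        (lintegral_finsetSum _ fun s _ => hg.comp (measurePreserving_swapAlong P s).measurable).symm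
    _ ≤ ∫⁻ _, 2 ^ Fintype.card ι * B ∂(Measure.pi fun _ : ι => P.prod P) := lintegral_mono hB
    _ = 2 ^ Fintype.card ι * B := by simp

end Symmetrization

/-! ### Uniform deviations -/

section UniformDeviation

variable {Z ι : Type*} [Fintype ι] [MeasurableSpace Z] [Countable Z] [DiscreteMeasurableSpace Z]
  (P : Measure Z) [IsProbabilityMeasure P] {F : Set (Z → ℝ)} {b : ℝ} {N : ℕ}

lemma measure_exists_le_deviation_le_exp (hF : ∀ f ∈ F, ∀ z, |f z| ≤ b)
    (hN : ∀ w : ι → Z × Z, (differencePatterns F w).encard ≤ N) (r : ℝ) :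
    (Measure.pi fun _ : ι => P)
        {S | ∃ f ∈ F, r ≤ |∑ i, f (S i) - Fintype.card ι * ∫ z, f z ∂P|} ≤
      ENNReal.ofReal (2 * N * Real.exp (2 * Fintype.card ι * b ^ 2 - r)) := by
  classical
  set μ := Measure.pi fun _ : ι => P
  let ghostMean : (ι → Z) → ENNReal := fun S =>
    ∫⁻ S', expSupDeviation F (fun i => (S i, S' i)) ∂μ
  have hint : ∀ f ∈ F, Integrable f P := fun f hf =>
    .of_bound Measurable.of_discrete.aestronglyMeasurable b (.of_forall (hF f hf))
  have hsub : {S | ∃ f ∈ F, r ≤ |∑ i, f (S i) - Fintype.card ι * ∫ z, f z ∂P|} ⊆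
      {S | ENNReal.ofReal (Real.exp r) ≤ ghostMean S} := by
    rintro S ⟨f, hf, hr⟩
    calc ENNReal.ofReal (Real.exp r)
        ≤ ENNReal.ofReal (Real.exp |∑ i, f (S i) - Fintype.card ι * ∫ z, f z ∂P|) := by gcongr
      _ ≤ ∫⁻ S', ENNReal.ofReal (Real.exp |∑ i, (f (S i) - f (S' i))|) ∂μ :=
          ofReal_exp_deviation_le_lintegral P (hint f hf) S
      _ ≤ ghostMean S := lintegral_mono fun S' => le_iSup₂_of_le f hf le_rfl
  have hmean : ∫⁻ S, ghostMean S ∂μ ≤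
      N * ENNReal.ofReal (2 * Real.exp (2 * Fintype.card ι * b ^ 2)) := by
    rw [lintegral_lintegral_pi_eq_lintegral_pi_prod P .of_discrete]
    exact lintegral_le_of_sum_swapAlong_le P .of_discrete fun w =>
      sum_expSupDeviation_swapAlong_le hF (hN w)
  calc μ {S | ∃ f ∈ F, r ≤ |∑ i, f (S i) - Fintype.card ι * ∫ z, f z ∂P|}
      ≤ μ {S | ENNReal.ofReal (Real.exp r) ≤ ghostMean S} := measure_mono hsub
    _ ≤ (∫⁻ S, ghostMean S ∂μ) / ENNReal.ofReal (Real.exp r) :=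
        meas_ge_le_lintegral_div Measurable.of_discrete.aemeasurable
          (ENNReal.ofReal_pos.2 (Real.exp_pos r)).ne' ENNReal.ofReal_ne_top
    _ ≤ N * ENNReal.ofReal (2 * Real.exp (2 * Fintype.card ι * b ^ 2)) /
          ENNReal.ofReal (Real.exp r) := by gcongr
    _ = ENNReal.ofReal (2 * N * Real.exp (2 * Fintype.card ι * b ^ 2 - r)) := by
        rw [← ENNReal.ofReal_natCast, ← ENNReal.ofReal_mul (by positivity),
          ← ENNReal.ofReal_div_of_pos (Real.exp_pos r), Real.exp_sub]
        ring_nf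

/-- Apply the exponential bound to the rescaled class `c • F`, with the optimal `c`. -/
lemma measure_exists_mul_le_deviation_le (hb : 0 < b) (hF : ∀ f ∈ F, ∀ z, |f z| ≤ b)
    (hN : ∀ w : ι → Z × Z, (differencePatterns F w).encard ≤ N) {r : ℝ} (hr : 0 ≤ r) :
    (Measure.pi fun _ : ι => P) {S | ∃ f ∈ F,
        Fintype.card ι * r ≤ |∑ i, f (S i) - Fintype.card ι * ∫ z, f z ∂P|} ≤
      ENNReal.ofReal (2 * N * Real.exp (-(Fintype.card ι * r ^ 2 / (8 * b ^ 2)))) := by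
  set c : ℝ := r / (4 * b ^ 2)
  have hc : 0 ≤ c := by positivity
  have hbound : ∀ f ∈ (c • ·) '' F, ∀ z, |f z| ≤ c * b := by
    rintro _ ⟨f, hf, rfl⟩ z
    simp only [Pi.smul_apply, smul_eq_mul, abs_mul, abs_of_nonneg hc]
    gcongr
    exact hF f hf z
  have hscaled := measure_exists_le_deviation_le_exp P hbound
    (fun w => (encard_differencePatterns_smul_le c F w).trans (hN w)) (c * (Fintype.card ι * r))
  have hexponent : 2 * Fintype.card ι * (c * b) ^ 2 - c * (Fintype.card ι * r) =
      -(Fintype.card ι * r ^ 2 / (8 * b ^ 2)) := by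
    simp only [c]
    field_simp
    ring
  rw [hexponent] at hscaled
  refine (measure_mono ?_).trans hscaled
  rintro S ⟨f, hf, hfr⟩
  refine ⟨c • f, Set.mem_image_of_mem _ hf, ?_⟩
  simp only [Pi.smul_apply, smul_eq_mul, ← Finset.mul_sum, integral_const_mul]
  rw [mul_left_comm (Fintype.card ι : ℝ), ← mul_sub, abs_mul, abs_of_nonneg hc]
  gcongr

end UniformDeviation

/-! ### Empirical risk minimization -/

section Risk

variable {X : Type*} {H : Set (X → Bool)} {loss : X × Bool → Bool → ℝ}

lemma IsRiskMinimizer.sInf_image_eq {R : (X → Bool) → ℝ} {h : X → Bool}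
    (hh : IsRiskMinimizer H R h) : sInf (R '' H) = R h :=
  IsLeast.csInf_eq ⟨Set.mem_image_of_mem R hh.1, Set.forall_mem_image.2 hh.2⟩

lemma abs_sub_sInf_image_le {α : Type*} {s : Set α} {R : α → ℝ} {a : α} {ε : ℝ} (ha : a ∈ s)
    (hle : ∀ b ∈ s, R a ≤ R b + ε) : |R a - sInf (R '' s)| ≤ ε := by
  have hlower : R a - ε ∈ lowerBounds (R '' s) :=
    Set.forall_mem_image.2 fun b hb => sub_le_iff_le_add.2 (hle b hb)
  have hinf_ge : R a - ε ≤ sInf (R '' s) := le_csInf ⟨_, Set.mem_image_of_mem R ha⟩ hlower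
  have hinf_le : sInf (R '' s) ≤ R a := csInf_le ⟨_, hlower⟩ (Set.mem_image_of_mem R ha)
  rw [abs_of_nonneg (sub_nonneg.2 hinf_le)]
  linarith

/-- The cost of predicting `h` instead of the constant `false`. The loss itself need not be bounded,
but this difference is. -/
def excessLoss (loss : X × Bool → Bool → ℝ) (h : X → Bool) (z : X × Bool) : ℝ :=
  if h z.1 then loss z true - loss z false else 0

lemma loss_eq_add_excessLoss (loss : X × Bool → Bool → ℝ) (h : X → Bool) (z : X × Bool) :
    loss z (h z.1) = loss z false + excessLoss loss h z := by
  cases hz : h z.1 <;> simp [excessLoss, hz]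

lemma abs_excessLoss_le (hloss : ∀ z, |loss z true - loss z false| ≤ 1) (h : X → Bool)
    (z : X × Bool) : |excessLoss loss h z| ≤ 1 := by
  cases hz : h z.1 <;> simp [excessLoss, hz, hloss]

lemma empiricalRisk_eq_add {n : ℕ} (S : Fin n → X × Bool) (h : X → Bool) :
    empiricalRisk loss S h = empiricalRisk loss S (fun _ => false) +
      (1 / (n : ℝ)) * ∑ i, excessLoss loss h (S i) := by
  simp only [empiricalRisk, loss_eq_add_excessLoss loss h, Finset.sum_add_distrib, mul_add]

lemma encard_differencePatterns_excessLoss_le {ι : Type*} [Fintype ι] {d : ℕ} (hH : VCDimLE H d)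
    (loss : X × Bool → Bool → ℝ) (w : ι → (X × Bool) × (X × Bool)) :
    (differencePatterns (excessLoss loss '' H) w).encard ≤
      (∑ k ∈ Finset.Iic d, (2 * Fintype.card ι).choose k : ℕ) := by
  classical
  let points : ι ⊕ ι → X := Sum.elim (fun i => (w i).1.1) fun i => (w i).2.1
  let gap : X × Bool → ℝ := fun z => loss z true - loss z false
  let pattern : Finset (ι ⊕ ι) → ι → ℝ := fun u i =>
    (if .inl i ∈ u then gap (w i).1 else 0) - if .inr i ∈ u then gap (w i).2 else 0
  have hsub : differencePatterns (excessLoss loss '' H) w ⊆ pattern '' traces H points := by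
    rintro _ ⟨_, ⟨h, hh, rfl⟩, rfl⟩
    refine ⟨Finset.univ.filter fun p => h (points p) = true,
      mem_traces.2 ⟨h, hh, by simp⟩, funext fun i => ?_⟩
    simp [pattern, points, gap, excessLoss]
  calc (differencePatterns (excessLoss loss '' H) w).encard
      ≤ (pattern '' traces H points).encard := Set.encard_mono hsub
    _ ≤ (traces H points : Set (Finset (ι ⊕ ι))).encard := Set.encard_image_le _ _
    _ = (traces H points).card := Set.encard_coe_eq_coe_finsetCard _
    _ ≤ _ := by
        rw [two_mul, ← Fintype.card_sum]
        exact_mod_cast hH.card_traces_le points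

variable [MeasurableSpace X] {P : Measure (X × Bool)}

lemma integrable_loss_comp (hint : ∀ b, Integrable (fun z => loss z b) P) {h : X → Bool}
    (hh : Measurable h) : Integrable (fun z => loss z (h z.1)) P := by
  classical
  have hpiecewise : (fun z => loss z (h z.1)) =
      Set.piecewise {z | h z.1 = true} (fun z => loss z true) fun z => loss z false := by
    ext z
    cases hz : h z.1 <;> simp [Set.piecewise, hz]
  rw [hpiecewise]
  exact Integrable.piecewise (hh.comp measurable_fst (measurableSet_singleton true))
    (hint true).integrableOn (hint false).integrableOn

lemma expectedRisk_eq_add (hint : ∀ b, Integrable (fun z => loss z b) P) {h : X → Bool}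
    (hh : Measurable h) :
    expectedRisk loss P h =
      expectedRisk loss P (fun _ => false) + ∫ z, excessLoss loss h z ∂P := by
  have hexcess : Integrable (excessLoss loss h) P := by
    convert (integrable_loss_comp hint hh).sub (hint false) using 1
    ext z
    simp [loss_eq_add_excessLoss loss h]
  simp only [expectedRisk, loss_eq_add_excessLoss loss h]
  exact integral_add (hint false) hexcess

lemma expectedRisk_le_add_one [IsProbabilityMeasure P]
    (hint : ∀ b, Integrable (fun z => loss z b) P)
    (hloss : ∀ z, |loss z true - loss z false| ≤ 1) {h g : X → Bool} (hh : Measurable h)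
    (hg : Measurable g) : expectedRisk loss P h ≤ expectedRisk loss P g + 1 := by
  have hpointwise : ∀ z, loss z (h z.1) ≤ loss z (g z.1) + 1 := by
    intro z
    have hz := abs_le.1 (hloss z)
    cases h z.1 <;> cases g z.1 <;> linarith
  calc expectedRisk loss P h
      ≤ ∫ z, (loss z (g z.1) + 1) ∂P :=
        integral_mono (integrable_loss_comp hint hh)
          ((integrable_loss_comp hint hg).add (integrable_const 1)) hpointwise
    _ = expectedRisk loss P g + 1 := by
        rw [integral_add (integrable_loss_comp hint hg) (integrable_const 1)]
        simp [expectedRisk]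

lemma expectedRisk_le_add_of_deviation_lt (hint : ∀ b, Integrable (fun z => loss z b) P)
    (hH : ∀ h ∈ H, Measurable h) {ε : ℝ} {n : ℕ} {S : Fin n → X × Bool}
    (hS : ∀ h ∈ H,
      |∑ i, excessLoss loss h (S i) - n * ∫ z, excessLoss loss h z ∂P| < n * (ε / 2))
    {hhat : X → Bool} (hmin : IsRiskMinimizer H (empiricalRisk loss S) hhat) {g : X → Bool}
    (hg : g ∈ H) : expectedRisk loss P hhat ≤ expectedRisk loss P g + ε := by
  have hdev_hat := abs_lt.1 (hS hhat hmin.1)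
  have hdev_g := abs_lt.1 (hS g hg)
  have hn : (0 : ℝ) < n := by
    refine Nat.cast_pos.2 (Nat.pos_of_ne_zero ?_)
    rintro rfl
    simpa using hS g hg
  have hsample : ∑ i, excessLoss loss hhat (S i) ≤ ∑ i, excessLoss loss g (S i) := by
    have hle := hmin.2 g hg
    rw [empiricalRisk_eq_add, empiricalRisk_eq_add S g] at hle
    exact le_of_mul_le_mul_left (le_of_add_le_add_left hle) (one_div_pos.2 hn)
  have hmean : n * ∫ z, excessLoss loss hhat z ∂P ≤ n * (∫ z, excessLoss loss g z ∂P + ε) := by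
    rw [mul_add]
    linarith
  rw [expectedRisk_eq_add hint (hH hhat hmin.1), expectedRisk_eq_add hint (hH g hg)]
  linarith [le_of_mul_le_mul_left hmean hn]

end Risk

/-! ### Sample complexity -/

section SampleComplexity

variable {X : Type*} [MeasurableSpace X] [Countable X] [DiscreteMeasurableSpace X]
  {P : Measure (X × Bool)} [IsProbabilityMeasure P] {loss : X × Bool → Bool → ℝ}
  {H : Set (X → Bool)} {d : ℕ}

lemma measure_exists_le_excessLoss_deviation_le (hH : VCDimLE H d)
    (hloss : ∀ z, |loss z true - loss z false| ≤ 1) {ε : ℝ} (hε : 0 < ε) (hε1 : ε ≤ 1) (n : ℕ) :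
    (Measure.pi fun _ : Fin n => P) {S | ∃ h ∈ H, n * (ε / 2) ≤
        |∑ i, excessLoss loss h (S i) - n * ∫ z, excessLoss loss h z ∂P|} ≤
      ENNReal.ofReal (2 * (128 / ε ^ 2) ^ d * Real.exp (-(n * ε ^ 2 / 64))) := by
  have hdeviation := measure_exists_mul_le_deviation_le (ι := Fin n) P one_pos
    (Set.forall_mem_image.2 fun h _ => abs_excessLoss_le hloss h)
    (encard_differencePatterns_excessLoss_le hH loss) (half_pos hε).le
  simp only [Set.exists_mem_image, Fintype.card_fin] at hdeviation
  refine hdeviation.trans (ENNReal.ofReal_le_ofReal ?_)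
  -- With `t = ε ^ 2 / 128` the growth of the class costs half of the exponent `n * ε ^ 2 / 32`.
  have hgrowth := sum_Iic_choose_le (2 * n) d (t := ε ^ 2 / 128) (by positivity) (by nlinarith)
  push_cast at hgrowth ⊢
  calc 2 * (∑ k ∈ Finset.Iic d, ((2 * n).choose k : ℝ)) *
        Real.exp (-(n * (ε / 2) ^ 2 / (8 * 1 ^ 2)))
      ≤ 2 * ((1 / (ε ^ 2 / 128)) ^ d * Real.exp (2 * n * (ε ^ 2 / 128))) *
        Real.exp (-(n * (ε / 2) ^ 2 / (8 * 1 ^ 2))) := by gcongr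
    _ = 2 * (128 / ε ^ 2) ^ d * Real.exp (-(n * ε ^ 2 / 64)) := by
        rw [one_div_div, mul_assoc, mul_assoc, ← Real.exp_add, ← mul_assoc]
        ring_nf

lemma one_sub_le_measure_riskMinimizer (hH : VCDimLE H d)
    (hint : ∀ b, Integrable (fun z => loss z b) P)
    (hloss : ∀ z, |loss z true - loss z false| ≤ 1) {ε : ℝ} (hε : 0 < ε) (hε1 : ε ≤ 1) (n : ℕ) :
    ENNReal.ofReal (1 - 2 * (128 / ε ^ 2) ^ d * Real.exp (-(n * ε ^ 2 / 64))) ≤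
      (Measure.pi fun _ : Fin n => P) {S | ∀ hhat, IsRiskMinimizer H (empiricalRisk loss S) hhat →
        ∀ g ∈ H, expectedRisk loss P hhat ≤ expectedRisk loss P g + ε} := by
  have hbad := measure_exists_le_excessLoss_deviation_le (P := P) hH hloss hε hε1 n
  rw [ENNReal.ofReal_sub _ (by positivity), ENNReal.ofReal_one]
  refine (tsub_le_tsub_left hbad 1).trans ?_
  rw [← prob_compl_eq_one_sub .of_discrete]
  refine measure_mono fun S hS hhat hmin g hg => ?_
  simp only [Set.mem_compl_iff, Set.mem_ofPred_eq, not_exists, not_and, not_le] at hS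
  exact expectedRisk_le_add_of_deviation_lt hint (fun _ _ => .of_discrete) hS hmin hg

end SampleComplexity

lemma log_failure_factor_le {d : ℕ} (hd : 1 ≤ d) {ε : ℝ} (hε : 0 < ε) (hε1 : ε ≤ 1) :
    Real.log (2 * (128 / ε ^ 2) ^ (d + 1)) ≤ d * (11 + 4 * Real.log (1 / ε)) := by
  have hlog_nonneg : 0 ≤ Real.log (1 / ε) := Real.log_nonneg ((one_le_div hε).2 hε1)
  have hd' : (1 : ℝ) ≤ d := by exact_mod_cast hd
  have hexpand : Real.log (2 * (128 / ε ^ 2) ^ (d + 1)) =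
      Real.log 2 + (d + 1) * (7 * Real.log 2 + 2 * Real.log (1 / ε)) := by
    rw [show (128 : ℝ) / ε ^ 2 = 2 ^ 7 * (1 / ε) ^ 2 by ring,
      Real.log_mul (by norm_num) (by positivity), Real.log_pow,
      Real.log_mul (by norm_num) (by positivity), Real.log_pow, Real.log_pow]
    push_cast
    ring
  rw [hexpand]
  nlinarith [Real.log_two_lt_d9, mul_nonneg (sub_nonneg.2 hd') hlog_nonneg]

lemma failure_bound_le {d n : ℕ} (hd : 1 ≤ d) {ε₀ ε δ : ℝ} (hε₀ : ε₀ < 1) (hε : 0 < ε)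
    (hεε₀ : ε ≤ ε₀) (hδ : 0 < δ) (hδ1 : δ ≤ 1)
    (hn : 64 * (11 / Real.log (1 / ε₀) + 4) *
      ((d * Real.log (1 / ε) + Real.log (1 / δ)) / ε ^ 2) ≤ n) :
    2 * (128 / ε ^ 2) ^ (d + 1) * Real.exp (-(n * ε ^ 2 / 64)) ≤ δ := by
  have hε₀_pos : 0 < ε₀ := hε.trans_le hεε₀
  set l₀ := Real.log (1 / ε₀)
  set l := Real.log (1 / ε)
  have hl₀ : 0 < l₀ := Real.log_pos ((one_lt_div hε₀_pos).2 hε₀)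
  have hl : l₀ ≤ l := Real.log_le_log (by positivity) (one_div_le_one_div_of_le hε hεε₀)
  have hlogδ : 0 ≤ Real.log (1 / δ) := Real.log_nonneg ((one_le_div hδ).2 hδ1)
  have hfactor : Real.log (2 * (128 / ε ^ 2) ^ (d + 1)) ≤ (11 / l₀ + 4) * (d * l) := by
    calc Real.log (2 * (128 / ε ^ 2) ^ (d + 1))
        ≤ d * (11 * 1 + 4 * l) :=
          (mul_one (11 : ℝ)).symm ▸ log_failure_factor_le hd hε (hεε₀.trans hε₀.le)
      _ ≤ d * (11 * (l / l₀) + 4 * l) := by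
          gcongr
          exact (one_le_div hl₀).2 hl
      _ = (11 / l₀ + 4) * (d * l) := by ring
  have hconfidence : Real.log (1 / δ) ≤ (11 / l₀ + 4) * Real.log (1 / δ) :=
    le_mul_of_one_le_left hlogδ (by linarith [div_pos (by norm_num : (0 : ℝ) < 11) hl₀])
  have hexponent : (11 / l₀ + 4) * (d * l + Real.log (1 / δ)) ≤ n * ε ^ 2 / 64 := by
    rw [← mul_div_assoc, div_le_iff₀ (by positivity)] at hn
    linarith
  rw [← Real.exp_log (by positivity : 0 < 2 * (128 / ε ^ 2) ^ (d + 1)), ← Real.exp_add,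
    ← Real.le_log_iff_exp_le hδ]
  have hlog_inv : Real.log (1 / δ) = -Real.log δ := by rw [one_div, Real.log_inv]
  linarith

lemma exists_const_failure_bound_le {ε₀ : ℝ} (hε₀ : ε₀ < 1) :
    ∃ C : ℝ, 0 < C ∧ ∀ (d n : ℕ) (ε δ : ℝ), 1 ≤ d → 0 < ε → ε ≤ ε₀ → 0 < δ → δ ≤ 1 →
      C * ((d * Real.log (1 / ε) + Real.log (1 / δ)) / ε ^ 2) ≤ n →
      2 * (128 / ε ^ 2) ^ (d + 1) * Real.exp (-(n * ε ^ 2 / 64)) ≤ δ := by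
  rcases le_or_gt ε₀ 0 with hε₀_nonpos | hε₀_pos
  · exact ⟨1, one_pos, fun _ _ _ _ _ hε hεε₀ => absurd (hεε₀.trans hε₀_nonpos) hε.not_ge⟩
  · have hlog : 0 < Real.log (1 / ε₀) := Real.log_pos ((one_lt_div hε₀_pos).2 hε₀)
    exact ⟨64 * (11 / Real.log (1 / ε₀) + 4), by positivity, fun _ _ _ _ hd hε hεε₀ hδ hδ1 hn =>
      failure_bound_le hd hε₀ hε hεε₀ hδ hδ1 hn⟩

/-! ### Weighted Chamfer classifiers -/

lemma TokenSeq.nonempty_fin {T : ℕ} (s : TokenSeq T) : Nonempty (Fin T) :=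
  ⟨s.1.head s.2⟩

/-- The vector of coefficients of `η_w(q, d)` as a linear form in `w`: its coordinate at `t`
collects the positions of the query that carry the token `t`. -/
noncomputable def chamferFeature {T m : ℕ} (encQ encD : Encoder T m)
    (x : TokenSeq T × TokenSeq T) (t : Fin T) : ℝ :=
  (1 / (x.1.len : ℝ)) * ∑ i : Fin x.1.len,
    if x.1.token i = t then ⨅ j : Fin x.2.len, ‖encQ x.1 i - encD x.2 j‖ else 0

lemma weightedChamfer_eq_linearCombination {T m : ℕ} (encQ encD : Encoder T m) (w : Fin T → ℝ)
    (q d : TokenSeq T) :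
    weightedChamfer encQ encD w q d =
      Fintype.linearCombination ℝ w (chamferFeature encQ encD (q, d)) := by
  simp only [weightedChamfer, chamferFeature, Fintype.linearCombination_apply, smul_eq_mul,
    Finset.mul_sum, Finset.sum_mul]
  rw [Finset.sum_comm]
  refine Finset.sum_congr rfl fun i _ => ?_
  simp only [mul_ite, ite_mul, mul_zero, zero_mul, Finset.sum_ite_eq, Finset.mem_univ, if_true]
  ring

lemma hypothesisClass_subset_affineHalfspaceClass {T m : ℕ} (encQ encD : Encoder T m) :
    hypothesisClass encQ encD ⊆ affineHalfspaceClass ℝ (chamferFeature encQ encD) := by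
  rintro h ⟨w, τ, hw⟩
  refine ⟨Fintype.linearCombination ℝ w, τ, fun ⟨q, d⟩ => ?_⟩
  rw [hw, weightedChamfer_eq_linearCombination, ge_iff_le]

end WeightedChamfer

open WeightedChamfer in
theorem mainTheorem4_general (ε₀ : ℝ) (hε₀ : ε₀ < 1) :
    ∃ C : ℝ, 0 < C ∧
      ∀ {X E : Type*} [MeasurableSpace X] [Countable X] [DiscreteMeasurableSpace X]
        [AddCommGroup E] [Module ℝ E] [Module.Finite ℝ E] [Nontrivial E]
        {φ : X → E} {H : Set (X → Bool)} (_ : H ⊆ affineHalfspaceClass ℝ φ)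
        {P : Measure (X × Bool)} [IsProbabilityMeasure P] {loss : X × Bool → Bool → ℝ}
        (_ : ∀ b, Integrable (fun z => loss z b) P)
        (_ : ∀ z, |loss z true - loss z false| ≤ 1)
        {ε δ : ℝ} (_ : 0 < ε) (_ : ε ≤ ε₀ ∨ 1 ≤ ε) (_ : 0 < δ) (_ : δ < 1)
        {n : ℕ} (_ : (n : ℝ) ≥
          C * ((Module.finrank ℝ E * Real.log (1 / ε) + Real.log (1 / δ)) / ε ^ 2)),
        (Measure.pi fun _ : Fin n => P)
          {S | ∀ hhat, IsRiskMinimizer H (empiricalRisk loss S) hhat →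
            |expectedRisk loss P hhat - sInf (expectedRisk loss P '' H)| ≤ ε ∧
            ∀ hstar, IsRiskMinimizer H (expectedRisk loss P) hstar →
              |expectedRisk loss P hhat - expectedRisk loss P hstar| ≤ ε}
          ≥ ENNReal.ofReal (1 - δ) := by
  obtain ⟨C, hC, hfailure⟩ := exists_const_failure_bound_le hε₀
  refine ⟨C, hC, ?_⟩
  intro X E _ _ _ _ _ _ _ φ H hH P _ loss hint hloss ε δ hε hεε₀ hδ hδ1 n hn
  suffices hgood : ENNReal.ofReal (1 - δ) ≤ (Measure.pi fun _ : Fin n => P)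
      {S | ∀ hhat, IsRiskMinimizer H (empiricalRisk loss S) hhat →
        ∀ g ∈ H, expectedRisk loss P hhat ≤ expectedRisk loss P g + ε} by
    refine hgood.trans (measure_mono fun S hS hhat hmin => ?_)
    have hinf := abs_sub_sInf_image_le hmin.1 (hS hhat hmin)
    exact ⟨hinf, fun hstar hstar_min => hstar_min.sInf_image_eq ▸ hinf⟩
  rcases hεε₀ with hsmall | hlarge
  · refine (ENNReal.ofReal_le_ofReal (sub_le_sub_left ?_ 1)).trans
      (one_sub_le_measure_riskMinimizer ((vcDimLE_affineHalfspaceClass φ).mono hH) hint hloss hε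
        (hsmall.trans hε₀.le) n)
    exact hfailure _ n ε δ Module.finrank_pos hε hsmall hδ hδ1.le hn
  · refine (ENNReal.ofReal_le_one.2 (by linarith)).trans
      (measure_univ.symm.trans_le (measure_mono fun S _ => ?_))
    exact fun hhat _ g _ =>
      (expectedRisk_le_add_one hint hloss .of_discrete .of_discrete).trans (by gcongr)

theorem mainTheorem4 (ε₀ : ℝ) (hε₀ : ε₀ < 1) :
    ∃ C : ℝ, 0 < C ∧
      ∀ (T m : ℕ) (encQ encD : WeightedChamfer.Encoder T m)
        (P : MeasureTheory.Measure
          ((WeightedChamfer.TokenSeq T × WeightedChamfer.TokenSeq T) × Bool))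
        [MeasureTheory.IsProbabilityMeasure P]
        (loss : (WeightedChamfer.TokenSeq T × WeightedChamfer.TokenSeq T) × Bool → Bool → ℝ)
        -- the risk is defined, and the loss is 1-Lipschitz in the prediction
        (_ : ∀ b, MeasureTheory.Integrable (fun z => loss z b) P)
        (_ : ∀ z, |loss z true - loss z false| ≤ 1)
        (ε δ : ℝ) (_ : 0 < ε) (_ : ε ≤ ε₀ ∨ 1 ≤ ε) (_ : 0 < δ) (_ : δ < 1)
        (n : ℕ) (_ : (n : ℝ) ≥ C * ((T * Real.log (1 / ε) + Real.log (1 / δ)) / ε ^ 2)),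
        MeasureTheory.Measure.pi (fun _ : Fin n => P)
          {S | ∀ hhat, WeightedChamfer.IsRiskMinimizer (WeightedChamfer.hypothesisClass encQ encD)
                (WeightedChamfer.empiricalRisk loss S) hhat →
              |WeightedChamfer.expectedRisk loss P hhat -
                  sInf (WeightedChamfer.expectedRisk loss P ''
                    WeightedChamfer.hypothesisClass encQ encD)| ≤ ε ∧
              ∀ hstar, WeightedChamfer.IsRiskMinimizer (WeightedChamfer.hypothesisClass encQ encD)
                  (WeightedChamfer.expectedRisk loss P) hstar →
                |WeightedChamfer.expectedRisk loss P hhat -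
                  WeightedChamfer.expectedRisk loss P hstar| ≤ ε}
          ≥ ENNReal.ofReal (1 - δ) := by
  obtain ⟨C, hC, hgeneral⟩ := mainTheorem4_general ε₀ hε₀
  refine ⟨C, hC, fun T m encQ encD P _ loss hint hloss ε δ hε hεε₀ hδ hδ1 n hn => ?_⟩
  have : Nonempty (Fin T) := P.nonempty_of_neZero.elim fun z => z.1.1.nonempty_fin
  exact hgeneral (WeightedChamfer.hypothesisClass_subset_affineHalfspaceClass encQ encD) hint hloss
    hε hεε₀ hδ hδ1 (by simpa using hn)
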